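/- All Hilbert spaces are finite-dimensional complex Hilbert spaces. A state is a positive semidefinite operator of trace one, and a state $\Phi$ is pure if $\Phi^2=\Phi$. For positive semidefinite operators $X,Y$ let $F(X,Y)=\big\|\sqrt{X}\sqrt{Y}\big\|_1^2$ denote the fidelity, where $\|\cdot\|_1$ is the trace norm. Let $\rho_{AB}$ be an arbitrary state on $\mathcal H_A\otimes\mathcal H_B$ and let $\Phi_{A'B'}$ be an arbitrary pure state on $\mathcal H_{A'}\otimes\mathcal H_{B'}$. The extractability of $\Phi_{A'B'}$ from $\rho_{AB}$ is $$\Xi(\rho_{AB}\to\Phi_{A'B'}):=\max_{\Lambda_A,\Lambda_B}F\big((\Lambda_A\otimes\Lambda_B)(\rho_{AB}),\,\Phi_{A'B'}\big),$$ where the maximum is taken over all quantum channels (completely positive trace-preserving linear maps) $\Lambda_A:\mathcal L(\mathcal H_A)\to\mathcal L(\mathcal H_{A'})$ and $\Lambda_B:\mathcal L(\mathcal H_B)\to\mathcal L(\mathcal H_{B'})$. The isometric fidelity is $$F_{\mathrm{iso}}(\rho_{AB}\to\Phi_{A'B'}):=\sup_{\sigma_{A''B''}}\ \sup_{V=V_A\otimes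 V_B}F\big(V\rho_{AB}V^\dagger,\,\Phi_{A'B'}\otimes\sigma_{A''B''}\big),$$ where the supremum is taken over all auxiliary Hilbert spaces $\mathcal H_{A''},\mathcal H_{B''}$ of arbitrary finite dimension, all isometries $V_A:\mathcal H_A\to\mathcal H_{A'}\otimes\mathcal H_{A''}$ and $V_B:\mathcal H_B\to\mathcal H_{B'}\otimes\mathcal H_{B''}$, and all states $\sigma_{A''B''}$ on $\mathcal H_{A''}\otimes\mathcal H_{B''}$; the spaces $(\mathcal H_{A'}\otimes\mathcal H_{A''})\otimes(\mathcal H_{B'}\otimes\mathcal H_{B''})$ and $(\mathcal H_{A'}\otimes\mathcal H_{B'})\otimes(\mathcal H_{A''}\otimes\mathcal H_{B''})$ are identified in the canonical way. Then the maximum defining the extractability is attained, the supremum defining the isometric fidelity is finite, and $$\Xi(\rho_{AB}\to\Phi_{A'B'})=F_{\mathrm{iso}}(\rho_{AB}\to\Phi_{A'B'}).$$ -/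

import Mathlib

open scoped Matrix Kronecker

section States

open scoped ComplexOrder

/-- A quantum state (density operator) on `ℂ^n`. -/
structure IsState {n : Type*} [Fintype n] (ρ : Matrix n n ℂ) : Prop where
  posSemidef : ρ.PosSemidef
  trace_eq_one : ρ.trace = 1

/-- A pure state: a state that is a projector. -/
structure IsPureState {n : Type*} [Fintype n] (Φ : Matrix n n ℂ) : Prop extends IsState Φ where
  mul_self_eq_self : Φ * Φ = Φ

end States

section Channels

open scoped ComplexOrder MatrixOrder Matrix.Norms.L2Operator

/-- The order on `k × k` matrices over `ℒ(ℂ^m)` that enters complete positivity is positive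
semidefiniteness of the corresponding operator on `ℂ^k ⊗ ℂ^m`. -/
theorem cstarMatrix_nonneg_iff_posSemidef {m : Type*} [Fintype m] [DecidableEq m] {k : ℕ}
    (M : CStarMatrix (Fin k) (Fin k) (Matrix m m ℂ)) :
    0 ≤ M ↔ (Matrix.comp (Fin k) (Fin k) m m ℂ (CStarMatrix.ofMatrix.symm M)).PosSemidef := by
  constructor
  · intro h
    rw [StarOrderedRing.nonneg_iff] at h
    induction h using AddSubmonoid.closure_induction with
    | mem x hx =>
      obtain ⟨N, rfl⟩ := hx
      have : Matrix.comp (Fin k) (Fin k) m m ℂ (CStarMatrix.ofMatrix.symm (star N * N))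
       = (Matrix.comp (Fin k) (Fin k) m m ℂ (CStarMatrix.ofMatrix.symm N))ᴴ *
         Matrix.comp (Fin k) (Fin k) m m ℂ (CStarMatrix.ofMatrix.symm N) := by
        ext ⟨i, a⟩ ⟨j, b⟩
        simp only [Matrix.comp_apply, Matrix.mul_apply, Fintype.sum_prod_type,
          Matrix.conjTranspose_apply]
        change ((star N * N) i j) a b = _
        rw [CStarMatrix.mul_apply, Matrix.sum_apply]
        rfl
      rw [this]
      exact Matrix.posSemidef_conjTranspose_mul_self _
    | zero => exact Matrix.PosSemidef.zero
    | add x y _ _ hx hy => exact hx.add hy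
  · intro h
    obtain ⟨Q, hQ⟩ : ∃ Q, Matrix.comp (Fin k) (Fin k) m m ℂ (CStarMatrix.ofMatrix.symm M) = Qᴴ * Q :=
      CStarAlgebra.nonneg_iff_eq_star_mul_self.mp h.nonneg
    have : M = star (CStarMatrix.ofMatrix ((Matrix.comp (Fin k) (Fin k) m m ℂ).symm Q)) *
       (CStarMatrix.ofMatrix ((Matrix.comp (Fin k) (Fin k) m m ℂ).symm Q)) := by
      ext i j a b
      have := congrFun (congrFun hQ (i, a)) (j, b)
      simp only [Matrix.comp_apply, Matrix.mul_apply, Fintype.sum_prod_type,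
        Matrix.conjTranspose_apply] at this
      refine this.trans ?_
      rw [CStarMatrix.mul_apply, Matrix.sum_apply]
      rfl
    rw [this]
    exact star_mul_self_nonneg _

/-- A quantum channel from `ℒ(ℂ^m)` to `ℒ(ℂ^n)`: a completely positive linear map which is
trace-preserving. Complete positivity refers to the operator norm and the Loewner order. -/
structure QuantumChannel (m n : Type*) [Fintype m] [DecidableEq m] [Fintype n] [DecidableEq n]
    extends CompletelyPositiveMap (Matrix m m ℂ) (Matrix n n ℂ) where
  trace_map : ∀ X : Matrix m m ℂ, (toLinearMap X).trace = X.trace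

/-- The linear map underlying a quantum channel. -/
noncomputable def QuantumChannel.toLin {m n : Type*} [Fintype m] [DecidableEq m] [Fintype n] [DecidableEq n]
    (Λ : QuantumChannel m n) :
    Matrix m m ℂ →ₗ[ℂ] Matrix n n ℂ where
  toFun X := Λ.toLinearMap X
  map_add' X Y := Λ.toLinearMap.map_add X Y
  map_smul' c X := Λ.toLinearMap.map_smul c X

end Channels

noncomputable section

/-- The tensor product `Λ ⊗ M` of two linear maps on operators, i.e. the linear map that sends
`X ⊗ Y` to `Λ X ⊗ M Y`. -/
def tensorMap {m n m' n' : Type*} [Fintype m] [DecidableEq m] [Fintype n] [DecidableEq n]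
    [Fintype m'] [DecidableEq m'] [Fintype n'] [DecidableEq n']
    (Λ : Matrix m m ℂ →ₗ[ℂ] Matrix m' m' ℂ) (M : Matrix n n ℂ →ₗ[ℂ] Matrix n' n' ℂ) :
    Matrix (m × n) (m × n) ℂ →ₗ[ℂ] Matrix (m' × n') (m' × n') ℂ :=
  (kroneckerLinearEquiv m' m' n' n' ℂ).toLinearMap ∘ₗ TensorProduct.map Λ M ∘ₗ
    (kroneckerLinearEquiv m m n n ℂ).symm.toLinearMap

section Fidelity

open scoped ComplexOrder MatrixOrder

/-- The trace norm (Schatten `1`-norm) `tr √(X† X)`. -/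
def traceNorm {n : Type*} [Fintype n] [DecidableEq n] (X : Matrix n n ℂ) : ℝ :=
  (CFC.sqrt (Xᴴ * X)).trace.re

/-- The fidelity `F(A, B) = ‖√A √B‖₁²` of two positive semidefinite operators. -/
def fidelity {n : Type*} [Fintype n] [DecidableEq n] (A B : Matrix n n ℂ) : ℝ :=
  traceNorm (CFC.sqrt A * CFC.sqrt B) ^ 2

end Fidelity

variable {A B A' B' : Type*} [Fintype A] [DecidableEq A] [Fintype B] [DecidableEq B]
  [Fintype A'] [DecidableEq A'] [Fintype B'] [DecidableEq B']

/-- The fidelities with the target `Φ_{A'B'}` that are achieved by applying local channels to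
`ρ_{AB}`. -/
def channelFidelities (ρ : Matrix (A × B) (A × B) ℂ) (Φ : Matrix (A' × B') (A' × B') ℂ) : Set ℝ :=
  {f | ∃ (ΛA : QuantumChannel A A') (ΛB : QuantumChannel B B'),
    f = fidelity (tensorMap ΛA.toLin ΛB.toLin ρ) Φ}

/-- The extractability `Ξ(ρ_{AB} → Φ_{A'B'})`. -/
def extractability (ρ : Matrix (A × B) (A × B) ℂ) (Φ : Matrix (A' × B') (A' × B') ℂ) : ℝ :=
  sSup (channelFidelities ρ Φ)

/-- The fidelities `F(V ρ_{AB} V†, Φ_{A'B'} ⊗ σ_{A''B''})` over all finite-dimensional auxiliary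
spaces `A'' = ℂ^p`, `B'' = ℂ^q`, all product isometries `V = V_A ⊗ V_B` with
`V_A : A → A' ⊗ A''` and `V_B : B → B' ⊗ B''`, and all auxiliary states `σ` on `A'' ⊗ B''`.
The reindexing identifies `(A' ⊗ A'') ⊗ (B' ⊗ B'')` with `(A' ⊗ B') ⊗ (A'' ⊗ B'')`. -/
def isometryFidelities (ρ : Matrix (A × B) (A × B) ℂ) (Φ : Matrix (A' × B') (A' × B') ℂ) : Set ℝ :=
  {f | ∃ (p q : ℕ) (VA : Matrix (A' × Fin p) A ℂ) (VB : Matrix (B' × Fin q) B ℂ)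
      (σ : Matrix (Fin p × Fin q) (Fin p × Fin q) ℂ),
    VAᴴ * VA = 1 ∧ VBᴴ * VB = 1 ∧ IsState σ ∧
    f = fidelity
      (((VA ⊗ₖ VB) * ρ * (VA ⊗ₖ VB)ᴴ).reindex
        (Equiv.prodProdProdComm A' (Fin p) B' (Fin q))
        (Equiv.prodProdProdComm A' (Fin p) B' (Fin q)))
      (Φ ⊗ₖ σ)}

/-- The isometric fidelity `F_iso(ρ_{AB} → Φ_{A'B'})`. -/
def isometricFidelity (ρ : Matrix (A × B) (A × B) ℂ) (Φ : Matrix (A' × B') (A' × B') ℂ) : ℝ :=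
  sSup (isometryFidelities ρ Φ)

end

/-! Fix local isometries and put `Y = VρV†`, regrouped as an operator on `(A'B')(A''B'')`.
Everything rests on one identity: the maximum of `F(Y, Φ ⊗ σ)` over states `σ` is `tr[Y(Φ ⊗ 1)]`.
Indeed `Φ = ww†` has rank one, so `Φ ⊗ σ = JσJ†` for an isometry `J`, and `F(Y, JσJ†) = F(J†YJ, σ) ≤
tr J†YJ`, with equality for `σ` proportional to `J†YJ` (`fidelity_pure_kronecker_le`,
`exists_isState_fidelity_pure_kronecker`). Tracing out `A''B''` turns `tr[Y(Φ ⊗ 1)]` into the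
overlap of `(Λ_A ⊗ Λ_B)(ρ)` with `Φ`, which is their fidelity because `Φ` is pure
(`trace_dilatedOperator_mul`, `fidelity_pure`).

Isometries define channels, and every channel arises this way from a dilation of a fixed dimension,
read off from its Choi matrix. Hence every isometric fidelity is dominated by a channel fidelity,
and every channel fidelity is an isometric one. The fixed dimension also makes the channel
fidelities a continuous image of a compact set, so that the maximum exists and bounds the isometric
fidelities. -/

/-! ### Pure states as rank-one projectors. -/

section PureStates

open scoped ComplexOrder

/-- A pure state is the rank-one projector onto a unit vector. -/
theorem IsPureState.exists_eq_mul_conjTranspose {n : Type*} [Fintype n] {Φ : Matrix n n ℂ}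
    (hΦ : IsPureState Φ) : ∃ W : Matrix n Unit ℂ, Wᴴ * W = 1 ∧ Φ = W * Wᴴ := by
  classical
  have hH : Φᴴ = Φ := hΦ.posSemidef.isHermitian
  have hP := hΦ.mul_self_eq_self
  obtain ⟨i, hi⟩ : ∃ i, Φ i i ≠ 0 := by
    by_contra! h
    have := hΦ.trace_eq_one
    simp [Matrix.trace, h] at this
  have hnn : 0 ≤ Φ i i := hΦ.posSemidef.diag_nonneg
  obtain ⟨hre, him⟩ := Complex.nonneg_iff.mp hnn
  have hc : ((Φ i i).re : ℂ) = Φ i i := by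
    apply Complex.ext <;> simp [him]
  have hpos : 0 < (Φ i i).re := lt_of_le_of_ne hre fun h => hi (by rw [← hc, ← h]; simp)
  set s : ℝ := Real.sqrt (Φ i i).re with hs
  have hs0 : (s : ℂ) ≠ 0 := by exact_mod_cast (Real.sqrt_pos.mpr hpos).ne'
  have hss : (s : ℂ) * s = Φ i i := by
    rw [← hc]; exact_mod_cast Real.mul_self_sqrt hre
  -- A nonzero column of `Φ`, normalised: `Φ² = Φ = Φ†` gives column `i` the squared norm `Φ i i`.
  let W : Matrix n Unit ℂ := Matrix.of fun a _ => (s : ℂ)⁻¹ * Φ a i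
  have hΦW : Φ * W = W := by
    ext a u
    simp only [W, Matrix.mul_apply, Matrix.of_apply]
    rw [← congrFun (congrFun hP a) i, Matrix.mul_apply, Finset.mul_sum]
    exact Finset.sum_congr rfl fun _ _ => by ring
  have hWW : Wᴴ * W = 1 := by
    ext a b
    have h1 : ∑ x, star (Φ x i) * Φ x i = Φ i i := by
      conv_rhs => rw [← hP, Matrix.mul_apply]
      refine Finset.sum_congr rfl fun x _ => ?_
      rw [← Matrix.conjTranspose_apply, hH]
    simp only [W, Matrix.mul_apply, Matrix.of_apply, Matrix.conjTranspose_apply]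
    have : ∀ x, star ((s : ℂ)⁻¹ * Φ x i) * ((s : ℂ)⁻¹ * Φ x i)
        = (s : ℂ)⁻¹ * (s : ℂ)⁻¹ * (star (Φ x i) * Φ x i) := by
      intro x
      simp only [star_mul', star_inv₀, RCLike.star_def, Complex.conj_ofReal]
      ring
    rw [Finset.sum_congr rfl fun x _ => this x, ← Finset.mul_sum, h1, ← hss]
    simp
    field_simp
  refine ⟨W, hWW, ?_⟩
  have hWΦ : Wᴴ * Φ = Wᴴ := by
    have := congrArg Matrix.conjTranspose hΦW
    rwa [Matrix.conjTranspose_mul, hH] at this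
  -- The difference is again a projector; its trace is `1 - 1 = 0`, so it vanishes.
  have hC : (Φ - W * Wᴴ)ᴴ * (Φ - W * Wᴴ) = Φ - W * Wᴴ := by
    rw [Matrix.conjTranspose_sub, Matrix.conjTranspose_mul, Matrix.conjTranspose_conjTranspose, hH,
      Matrix.sub_mul, Matrix.mul_sub, Matrix.mul_sub, hP, ← Matrix.mul_assoc Φ, hΦW,
      Matrix.mul_assoc W Wᴴ Φ, hWΦ, Matrix.mul_assoc W, ← Matrix.mul_assoc Wᴴ W, hWW,
      Matrix.one_mul]
    simp
  have h0 : Φ - W * Wᴴ = 0 := by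
    rw [← Matrix.trace_conjTranspose_mul_self_eq_zero_iff, hC, Matrix.trace_sub,
      hΦ.trace_eq_one, Matrix.trace_mul_comm, hWW]
    simp
  exact sub_eq_zero.mp h0

end PureStates

/-! ### Square roots, pseudo-inverses and the fidelity. -/

section FidelityLemmas

open scoped ComplexOrder MatrixOrder

variable {n m : Type*} [Fintype n] [DecidableEq n] [Fintype m] [DecidableEq m]

namespace Matrix.PosSemidef

theorem cfcSqrt (X : Matrix n n ℂ) : (CFC.sqrt X).PosSemidef :=
  Matrix.nonneg_iff_posSemidef.mp (CFC.sqrt_nonneg X)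

theorem cfcSqrt_mul_cfcSqrt {X : Matrix n n ℂ} (hX : X.PosSemidef) :
    CFC.sqrt X * CFC.sqrt X = X :=
  CFC.sqrt_mul_sqrt_self X hX.nonneg

theorem cfcSqrt_eq {X S : Matrix n n ℂ} (hS : S.PosSemidef) (h : S * S = X) :
    CFC.sqrt X = S :=
  CFC.sqrt_unique h hS.nonneg

theorem ofReal_trace_re {k : Type*} [Fintype k] {X : Matrix k k ℂ} (hX : X.PosSemidef) : (X.trace.re : ℂ) = X.trace := by
  obtain ⟨-, him⟩ := Complex.nonneg_iff.mp hX.trace_nonneg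
  apply Complex.ext <;> simp [him]

theorem trace_re_nonneg {k : Type*} [Fintype k] {X : Matrix k k ℂ} (hX : X.PosSemidef) : 0 ≤ X.trace.re :=
  (Complex.nonneg_iff.mp hX.trace_nonneg).1

theorem trace_mul_re_nonneg {X Y : Matrix n n ℂ} (hX : X.PosSemidef) (hY : Y.PosSemidef) :
    0 ≤ (X * Y).trace.re := by
  have h := (hX.conjTranspose_mul_mul_same (CFC.sqrt Y)).trace_re_nonneg
  rwa [(cfcSqrt Y).isHermitian.eq, Matrix.trace_mul_comm, ← Matrix.mul_assoc,
    cfcSqrt_mul_cfcSqrt hY, Matrix.trace_mul_comm] at h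

/-- The square root commutes with conjugation by an isometry. -/
theorem cfcSqrt_isometry_conj {X : Matrix m m ℂ} (hX : X.PosSemidef) {W : Matrix n m ℂ}
    (hW : Wᴴ * W = 1) : CFC.sqrt (W * X * Wᴴ) = W * CFC.sqrt X * Wᴴ := by
  refine cfcSqrt_eq ((cfcSqrt X).mul_mul_conjTranspose_same W) ?_
  calc W * CFC.sqrt X * Wᴴ * (W * CFC.sqrt X * Wᴴ)
      = W * CFC.sqrt X * (Wᴴ * W) * CFC.sqrt X * Wᴴ := by simp only [Matrix.mul_assoc]
    _ = W * (CFC.sqrt X * CFC.sqrt X) * Wᴴ := by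
      rw [hW, Matrix.mul_one]; simp only [Matrix.mul_assoc]
    _ = W * X * Wᴴ := by rw [cfcSqrt_mul_cfcSqrt hX]

/-- A positive semidefinite matrix has a Moore-Penrose inverse. -/
theorem exists_pinv {S : Matrix n n ℂ} (hS : S.PosSemidef) :
    ∃ T : Matrix n n ℂ, Tᴴ = T ∧ T * S = S * T ∧ T * S * T = T ∧ S * T * S = S := by
  have hs : IsSelfAdjoint S := hS.isHermitian
  -- The spectrum is finite, so the functional calculus accepts even `x⁻¹`; the convention `0⁻¹ = 0`
  -- makes the result the pseudo-inverse.
  have hc : ∀ f : ℝ → ℝ, ContinuousOn f (spectrum ℝ S) := fun f =>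
    (Matrix.finite_real_spectrum (A := S)).continuousOn f
  have hid : cfc (fun x : ℝ => x) S = S := cfc_id' ℝ S
  have hTS : cfc (fun x : ℝ => x⁻¹) S * S = cfc (fun x : ℝ => x⁻¹ * x) S := by
    conv_lhs => rw [← hid]
    rw [hid, cfc_mul _ _ S (hc _) (hc _), hid]
  have hST : S * cfc (fun x : ℝ => x⁻¹) S = cfc (fun x : ℝ => x⁻¹ * x) S := by
    have h := (cfc_commute_cfc (fun x : ℝ => x) (fun x : ℝ => x⁻¹) S).eq
    rw [hid] at h
    rw [h, hTS]
  refine ⟨cfc (fun x : ℝ => x⁻¹) S, ?_, ?_, ?_, ?_⟩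
  · exact cfc_predicate (fun x : ℝ => x⁻¹) S
  · rw [hTS, hST]
  · rw [hTS, ← cfc_mul _ _ S (hc _) (hc _)]
    congr 1; ext x; by_cases h : x = 0 <;> simp [h]
  · rw [hST]
    conv_lhs => rw [← hid]
    rw [hid]
    nth_rw 2 [← hid]
    rw [← cfc_mul _ _ S (hc _) (hc _)]
    conv_rhs => rw [← hid]
    congr 1; ext x; by_cases h : x = 0 <;> simp [h]

end Matrix.PosSemidef

open Matrix.PosSemidef

theorem fidelity_eq {Y σ : Matrix n n ℂ} (hY : Y.PosSemidef) :
    fidelity Y σ = (CFC.sqrt (CFC.sqrt σ * Y * CFC.sqrt σ)).trace.re ^ 2 := by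
  rw [fidelity, traceNorm, Matrix.conjTranspose_mul, (cfcSqrt Y).isHermitian.eq,
    (cfcSqrt σ).isHermitian.eq, Matrix.mul_assoc, ← Matrix.mul_assoc (CFC.sqrt Y),
    cfcSqrt_mul_cfcSqrt hY, Matrix.mul_assoc]

/-- The square root passes through `W`, so `√(WσW†) Y √(WσW†)` is the `W`-conjugate of the
corresponding operator for `W†YW` and `σ`. A second square root and cyclicity of the trace remove
`W`. -/
theorem fidelity_isometry_conj {Y : Matrix n n ℂ} (hY : Y.PosSemidef) {σ : Matrix m m ℂ}
    (hσ : σ.PosSemidef) {W : Matrix n m ℂ} (hW : Wᴴ * W = 1) :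
    fidelity Y (W * σ * Wᴴ) = fidelity (Wᴴ * Y * W) σ := by
  have hYW : (Wᴴ * Y * W).PosSemidef := hY.conjTranspose_mul_mul_same W
  have hQ : (CFC.sqrt σ * (Wᴴ * Y * W) * CFC.sqrt σ).PosSemidef := by
    have := hYW.conjTranspose_mul_mul_same (CFC.sqrt σ)
    rwa [(cfcSqrt σ).isHermitian.eq] at this
  rw [fidelity_eq hY, fidelity_eq hYW, cfcSqrt_isometry_conj hσ hW]
  have : W * CFC.sqrt σ * Wᴴ * Y * (W * CFC.sqrt σ * Wᴴ)
      = W * (CFC.sqrt σ * (Wᴴ * Y * W) * CFC.sqrt σ) * Wᴴ := by simp only [Matrix.mul_assoc]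
  rw [this, cfcSqrt_isometry_conj hQ hW, Matrix.trace_mul_comm, ← Matrix.mul_assoc, hW,
    Matrix.one_mul]

/-- The Cauchy-Schwarz bound for the fidelity with a state. -/
theorem fidelity_le_trace {Z σ : Matrix n n ℂ} (hZ : Z.PosSemidef) (hσ : IsState σ) :
    fidelity Z σ ≤ Z.trace.re := by
  rw [fidelity_eq hZ]
  set Q := CFC.sqrt σ with hQdef
  set P := CFC.sqrt Z with hPdef
  have hQ : Qᴴ = Q := (cfcSqrt σ).isHermitian
  have hP : Pᴴ = P := (cfcSqrt Z).isHermitian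
  have hQQ : Q * Q = σ := cfcSqrt_mul_cfcSqrt hσ.posSemidef
  have hPP : P * P = Z := cfcSqrt_mul_cfcSqrt hZ
  set S := CFC.sqrt (Q * Z * Q) with hSdef
  have hS : S.PosSemidef := cfcSqrt _
  have hQZQ : (Q * Z * Q).PosSemidef := by
    have := hZ.conjTranspose_mul_mul_same Q
    rwa [hQ] at this
  have hSS : S * S = Q * Z * Q := cfcSqrt_mul_cfcSqrt hQZQ
  obtain ⟨T, hT, hcomm, hTST, hSTS⟩ := hS.exists_pinv
  -- `U†` is the partial isometry in the polar decomposition `PQ = U†S`, where `S = |PQ|`.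
  set U := T * Q * P with hU
  have hUH : Uᴴ = P * Q * T := by
    rw [hU, Matrix.conjTranspose_mul, Matrix.conjTranspose_mul, hT, hQ, hP, Matrix.mul_assoc]
  have hUPQ : U * P * Q = S := by
    calc U * P * Q = T * (Q * (P * P) * Q) := by simp only [hU, Matrix.mul_assoc]
      _ = T * S * S := by rw [hPP, ← hSS, Matrix.mul_assoc]
      _ = S := by rw [hcomm, hSTS]
  have hUU : U * Uᴴ = T * S := by
    calc U * Uᴴ = T * (Q * (P * P) * Q) * T := by rw [hUH]; simp only [hU, Matrix.mul_assoc]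
      _ = T * S * (S * T) := by rw [hPP, ← hSS]; simp only [Matrix.mul_assoc]
      _ = T * S := by rw [← hcomm, ← Matrix.mul_assoc, hTST]
  have hUUU : U * Uᴴ * U = U := by
    rw [hUU, hU]
    calc T * S * (T * Q * P) = T * S * T * Q * P := by simp only [Matrix.mul_assoc]
      _ = _ := by rw [hTST]
  have hproj : (1 - Uᴴ * U).PosSemidef := by
    have h : (1 - Uᴴ * U)ᴴ * (1 - Uᴴ * U) = 1 - Uᴴ * U := by
      rw [Matrix.conjTranspose_sub, Matrix.conjTranspose_mul, Matrix.conjTranspose_conjTranspose,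
        Matrix.conjTranspose_one, Matrix.sub_mul, Matrix.mul_sub, Matrix.mul_sub,
        ← Matrix.mul_assoc (Uᴴ * U), Matrix.mul_assoc Uᴴ U Uᴴ, Matrix.mul_assoc Uᴴ (U * Uᴴ) U, hUUU]
      simp
    rw [← h]
    exact Matrix.posSemidef_conjTranspose_mul_self _
  have h1 : (U * Z * Uᴴ).trace.re ≤ Z.trace.re := by
    have h := hZ.trace_mul_re_nonneg hproj
    rw [Matrix.mul_sub, Matrix.mul_one, Matrix.trace_sub, Complex.sub_re] at h
    have : (U * Z * Uᴴ).trace = (Z * (Uᴴ * U)).trace := by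
      rw [Matrix.mul_assoc, Matrix.trace_mul_comm, Matrix.mul_assoc]
    rw [this]; linarith
  refine le_trans ?_ h1
  set t : ℝ := S.trace.re with ht
  -- Cauchy-Schwarz by completing the square: as `tr σ = 1`, taking the coefficient `t = tr S`
  -- leaves `tr(UZU†) - t² ≥ 0`.
  have h2 := (Matrix.posSemidef_conjTranspose_mul_self ((t : ℂ) • Q - P * Uᴴ)).trace_re_nonneg
  have hexp : ((t : ℂ) • Q - P * Uᴴ)ᴴ * ((t : ℂ) • Q - P * Uᴴ)
      = ((t : ℂ) * t) • σ - (t : ℂ) • (Q * P * Uᴴ) - (t : ℂ) • S + U * Z * Uᴴ := by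
    rw [Matrix.conjTranspose_sub, Matrix.conjTranspose_mul, Matrix.conjTranspose_conjTranspose,
      Matrix.conjTranspose_smul, hP, hQ, Matrix.sub_mul, Matrix.mul_sub, Matrix.mul_sub,
      ← hQQ, ← hUPQ, ← hPP]
    simp only [Matrix.smul_mul, Matrix.mul_smul, Matrix.mul_assoc, RCLike.star_def,
      Complex.conj_ofReal, smul_smul]
    abel
  have hconj : (Q * P * Uᴴ) = S := by
    have h := hS.isHermitian.eq
    rwa [← hUPQ, Matrix.conjTranspose_mul, Matrix.conjTranspose_mul, hQ, hP, hUPQ,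
      ← Matrix.mul_assoc] at h
  rw [hexp, hconj] at h2
  simp only [Matrix.trace_add, Matrix.trace_sub, Matrix.trace_smul, hσ.trace_eq_one, smul_eq_mul,
    Complex.add_re, Complex.sub_re, Complex.re_ofReal_mul, mul_one, ← ht,
    Complex.ofReal_re] at h2
  nlinarith [h2]

/-- The bound `F(Z, σ) ≤ tr Z` is attained at a state proportional to `Z`. -/
theorem exists_isState_fidelity_eq_trace [Nonempty n] {Z : Matrix n n ℂ} (hZ : Z.PosSemidef) :
    ∃ σ : Matrix n n ℂ, IsState σ ∧ fidelity Z σ = Z.trace.re := by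
  rcases hZ.trace_re_nonneg.eq_or_lt with h0 | hpos
  -- When `tr Z = 0` any state works; the maximally mixed one is taken.
  · have hσ : IsState (((Fintype.card n : ℝ)⁻¹ : ℝ) • (1 : Matrix n n ℂ)) := by
      refine ⟨Matrix.PosSemidef.one.smul (by positivity), ?_⟩
      simp [Matrix.trace_smul]
    refine ⟨_, hσ, le_antisymm (fidelity_le_trace hZ hσ) ?_⟩
    rw [← h0]
    exact sq_nonneg _
  · set p := Z.trace.re with hp
    set σ : Matrix n n ℂ := p⁻¹ • Z with hσdef
    have hσP : σ.PosSemidef := hZ.smul (by positivity)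
    have hσ : IsState σ := by
      refine ⟨hσP, ?_⟩
      rw [hσdef, Matrix.trace_smul, ← hZ.ofReal_trace_re, ← hp, Complex.real_smul]
      rw [← Complex.ofReal_mul, inv_mul_cancel₀ hpos.ne', Complex.ofReal_one]
    have hZσ : Z = p • σ := by rw [hσdef, smul_smul, mul_inv_cancel₀ hpos.ne', one_smul]
    refine ⟨σ, hσ, ?_⟩
    have hsq : CFC.sqrt (CFC.sqrt σ * Z * CFC.sqrt σ) = Real.sqrt p • σ := by
      refine cfcSqrt_eq (hσP.smul (Real.sqrt_nonneg p)) ?_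
      have hQQ := cfcSqrt_mul_cfcSqrt hσP
      generalize CFC.sqrt σ = Q at hQQ ⊢
      clear_value σ
      rw [hZσ, ← hQQ]
      simp only [Matrix.mul_smul, Matrix.smul_mul, smul_smul, Real.mul_self_sqrt hpos.le,
        Matrix.mul_assoc]
    rw [fidelity_eq hZ, hsq, Matrix.trace_smul, hσ.trace_eq_one]
    simp [Real.sq_sqrt hpos.le]

/-- The fidelity with a pure state is the overlap. -/
theorem fidelity_pure {X Φ : Matrix n n ℂ} (hX : X.PosSemidef) (hΦ : IsPureState Φ) :
    fidelity X Φ = (X * Φ).trace.re := by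
  obtain ⟨W, hW, rfl⟩ := hΦ.exists_eq_mul_conjTranspose
  have hXW := hX.conjTranspose_mul_mul_same W
  obtain ⟨σ, hσ, h⟩ := exists_isState_fidelity_eq_trace hXW
  -- A one-dimensional space has only one state, so the bound is attained at `1`.
  have h1 : σ = 1 := by
    ext i j
    have := hσ.trace_eq_one
    simpa [Matrix.trace] using this
  have h2 := fidelity_isometry_conj hX (Matrix.PosSemidef.one (n := Unit) (R := ℂ)) hW
  rw [Matrix.mul_one] at h2
  rw [h2, ← h1, h, Matrix.mul_assoc, Matrix.trace_mul_comm, Matrix.mul_assoc]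

/-! ### Optimising over the auxiliary state. -/

section Tensor

variable {E : Type*} [Fintype E] [DecidableEq E]

/-- Tensoring with a rank-one projector is conjugation by an isometry. -/
theorem pure_kronecker_eq_conj {k : Type*} [Fintype k] {W : Matrix k Unit ℂ} (hW : Wᴴ * W = 1) :
    ∃ J : Matrix (k × E) E ℂ, Jᴴ * J = 1 ∧
      ∀ σ : Matrix E E ℂ, (W * Wᴴ) ⊗ₖ σ = J * σ * Jᴴ := by
  let J : Matrix (k × E) E ℂ := (W ⊗ₖ (1 : Matrix E E ℂ)).submatrix id fun e => ((), e)
  have hJ : ∀ a e e', J (a, e) e' = W a () * (1 : Matrix E E ℂ) e e' := fun _ _ _ => rfl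
  refine ⟨J, ?_, fun σ => ?_⟩
  · ext e e'
    have h := congrFun (congrFun hW ()) ()
    simp only [Matrix.mul_apply, Matrix.conjTranspose_apply, Matrix.one_apply_eq] at h
    simp only [Matrix.mul_apply, Matrix.conjTranspose_apply, Fintype.sum_prod_type, hJ, star_mul']
    calc ∑ a, ∑ x, star (W a ()) * star ((1 : Matrix E E ℂ) x e) * (W a () * (1 : Matrix E E ℂ) x e')
        = ∑ a, (star (W a ()) * W a ()) * (1 : Matrix E E ℂ) e e' := by
          refine Finset.sum_congr rfl fun a _ => ?_
          rw [Finset.sum_eq_single e (fun x _ hx => by simp [Matrix.one_apply_ne hx])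
            (fun h => absurd (Finset.mem_univ _) h)]
          simp [mul_assoc]
      _ = _ := by rw [← Finset.sum_mul, h, one_mul]
  · ext ⟨a, e⟩ ⟨b, f⟩
    simp only [Matrix.kroneckerMap_apply, Matrix.mul_apply, Matrix.conjTranspose_apply, hJ,
      star_mul', Finset.univ_unique, Finset.sum_singleton, Matrix.one_apply]
    simp
    ring

variable {Φ : Matrix n n ℂ} {Y : Matrix (n × E) (n × E) ℂ}

theorem fidelity_pure_kronecker_le (hΦ : IsPureState Φ) (hY : Y.PosSemidef) {σ : Matrix E E ℂ}
    (hσ : IsState σ) : fidelity Y (Φ ⊗ₖ σ) ≤ (Y * (Φ ⊗ₖ (1 : Matrix E E ℂ))).trace.re := by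
  obtain ⟨W, hW, rfl⟩ := hΦ.exists_eq_mul_conjTranspose
  obtain ⟨J, hJ, h⟩ := pure_kronecker_eq_conj (E := E) hW
  rw [h, h, fidelity_isometry_conj hY hσ.posSemidef hJ, Matrix.mul_one, ← Matrix.mul_assoc,
    Matrix.trace_mul_comm, ← Matrix.mul_assoc]
  exact fidelity_le_trace (hY.conjTranspose_mul_mul_same J) hσ

theorem exists_isState_fidelity_pure_kronecker [Nonempty E] (hΦ : IsPureState Φ)
    (hY : Y.PosSemidef) : ∃ σ : Matrix E E ℂ, IsState σ ∧
      fidelity Y (Φ ⊗ₖ σ) = (Y * (Φ ⊗ₖ (1 : Matrix E E ℂ))).trace.re := by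
  obtain ⟨W, hW, rfl⟩ := hΦ.exists_eq_mul_conjTranspose
  obtain ⟨J, hJ, h⟩ := pure_kronecker_eq_conj (E := E) hW
  obtain ⟨σ, hσ, hF⟩ := exists_isState_fidelity_eq_trace (hY.conjTranspose_mul_mul_same J)
  refine ⟨σ, hσ, ?_⟩
  rw [h, h, fidelity_isometry_conj hY hσ.posSemidef hJ, Matrix.mul_one, ← Matrix.mul_assoc,
    Matrix.trace_mul_comm, ← Matrix.mul_assoc, hF]

end Tensor

end FidelityLemmas

/-! ### Stinespring dilations and Kraus maps. -/

section Kraus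

open scoped ComplexOrder MatrixOrder Matrix.Norms.L2Operator

/-- The Kraus operators of an operator `V : ℂ^m → ℂ^n ⊗ ℂ^p`. -/
def krausOperator {m n : Type*} {p : ℕ} (V : Matrix (n × Fin p) m ℂ) (r : Fin p) : Matrix n m ℂ :=
  Matrix.of fun a i => V (a, r) i

/-- The completely positive map `X ↦ tr_p (V X V†)`. -/
def krausMap {m n : Type*} [Fintype m] {p : ℕ} (V : Matrix (n × Fin p) m ℂ) : Matrix m m ℂ →ₗ[ℂ] Matrix n n ℂ where
  toFun X := ∑ r, krausOperator V r * X * (krausOperator V r)ᴴ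
  map_add' X Y := by simp only [Matrix.mul_add, Matrix.add_mul, Finset.sum_add_distrib]
  map_smul' c X := by
    simp only [Matrix.mul_smul, Matrix.smul_mul, Finset.smul_sum, RingHom.id_apply]

theorem krausMap_apply {m n : Type*} [Fintype m] {p : ℕ} (V : Matrix (n × Fin p) m ℂ) (X : Matrix m m ℂ) :
    krausMap V X = ∑ r, krausOperator V r * X * (krausOperator V r)ᴴ := rfl

variable {m n : Type*} [Fintype m] [DecidableEq m] [Fintype n] [DecidableEq n]

/-- A quantum channel has a Stinespring dilation of a fixed dimension. -/
theorem QuantumChannel.exists_stinespring (Λ : QuantumChannel m n) :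
    ∃ V : Matrix (n × Fin (Fintype.card m * Fintype.card n)) m ℂ, Vᴴ * V = 1 ∧
      Λ.toLin = krausMap V := by
  let k := Fintype.card m
  let e : m ≃ Fin k := Fintype.equivFin m
  let M : CStarMatrix (Fin k) (Fin k) (Matrix m m ℂ) :=
    CStarMatrix.ofMatrix (Matrix.of fun i j => Matrix.single (e.symm i) (e.symm j) 1)
  have hM : 0 ≤ M := by
    rw [cstarMatrix_nonneg_iff_posSemidef]
    have : Matrix.comp (Fin k) (Fin k) m m ℂ (CStarMatrix.ofMatrix.symm M)
        = Matrix.vecMulVec (fun x : Fin k × m => if e.symm x.1 = x.2 then (1 : ℂ) else 0)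
          (star fun x : Fin k × m => if e.symm x.1 = x.2 then (1 : ℂ) else 0) := by
      ext ⟨i, a⟩ ⟨j, b⟩
      rw [Matrix.comp_apply, Matrix.vecMulVec_apply]
      change Matrix.single (e.symm i) (e.symm j) (1 : ℂ) a b = _
      rw [Matrix.single_apply]
      by_cases h1 : e.symm i = a <;> by_cases h2 : e.symm j = b <;> simp [h1, h2]
    rw [this]
    exact Matrix.posSemidef_vecMulVec_self_star _
  -- `M` is the unnormalised maximally entangled projector, so its image is the Choi matrix of `Λ`.
  -- In a factorisation `Q†Q`, the conjugated rows of `Q` are the Kraus operators; there are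
  -- `|m||n|` of them whatever `Λ` is.
  have hC := Λ.map_cstarMatrix_nonneg' k M hM
  rw [cstarMatrix_nonneg_iff_posSemidef] at hC
  obtain ⟨Q, hQ⟩ := CStarAlgebra.nonneg_iff_eq_star_mul_self.mp hC.nonneg
  let f : Fin (Fintype.card m * Fintype.card n) ≃ Fin k × n :=
    finProdFinEquiv.symm.trans (Equiv.prodCongr (Equiv.refl _) (Fintype.equivFin n).symm)
  let V : Matrix (n × Fin (Fintype.card m * Fintype.card n)) m ℂ :=
    Matrix.of fun x i => star (Q (f x.2) (e i, x.1))
  have hV : ∀ i j a b, Λ.toLin (Matrix.single i j 1) a b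
      = ∑ r, V (a, r) i * star (V (b, r) j) := by
    intro i j a b
    have h := congrFun (congrFun hQ (e i, a)) (e j, b)
    rw [Matrix.comp_apply, Matrix.star_eq_conjTranspose, Matrix.mul_apply] at h
    have h' : Λ.toLin (Matrix.single i j 1) a b =
      ∑ x, Qᴴ (e i, a) x * Q x (e j, b) := by
      rw [← h]
      change _ = (Λ.toLinearMap (Matrix.single (e.symm (e i)) (e.symm (e j)) 1)) a b
      rw [e.symm_apply_apply, e.symm_apply_apply]
      rfl
    rw [h', ← f.sum_comp]
    simp [V, Matrix.conjTranspose_apply]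
  refine ⟨V, ?_, ?_⟩
  · ext j i
    have h : (Λ.toLin (Matrix.single i j 1)).trace = (Matrix.single i j (1 : ℂ)).trace :=
      Λ.trace_map _
    simp only [Matrix.trace, Matrix.diag_apply, hV] at h
    rw [Matrix.mul_apply, Fintype.sum_prod_type]
    simp only [Matrix.conjTranspose_apply]
    calc ∑ a, ∑ r, star (V (a, r) j) * V (a, r) i
        = ∑ a, ∑ r, V (a, r) i * star (V (a, r) j) := by simp only [mul_comm]
      _ = _ := by
        rw [h]
        by_cases hij : j = i
        · subst hij
          simp [Matrix.single_apply]
        · rw [Matrix.one_apply_ne hij]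
          refine Finset.sum_eq_zero fun x _ => ?_
          rw [Matrix.single_apply, if_neg]
          rintro ⟨rfl, rfl⟩
          exact hij rfl
  · refine Matrix.ext_linearMap _ fun i j => LinearMap.ext_ring ?_
    ext a b
    simp only [LinearMap.comp_apply, Matrix.singleLinearMap_apply]
    rw [hV, krausMap_apply, Matrix.sum_apply]
    refine Finset.sum_congr rfl fun r _ => ?_
    rw [Matrix.mul_apply, Finset.sum_eq_single j, Matrix.mul_single_apply_same]
    · simp [krausOperator]
    · intro x _ hx
      rw [Matrix.mul_single_apply_of_ne _ _ _ _ _ hx]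
      simp
    · simp

/-- A map given by an isometry is a quantum channel. -/
def krausChannel {p : ℕ} (V : Matrix (n × Fin p) m ℂ) (hV : Vᴴ * V = 1) : QuantumChannel m n where
  toLinearMap := krausMap V
  map_cstarMatrix_nonneg' k M hM := by
    rw [cstarMatrix_nonneg_iff_posSemidef] at hM ⊢
    -- Amplifying by `k` turns conjugation by each Kraus operator `K` into conjugation by `1 ⊗ K`,
    -- which preserves positivity.
    have : Matrix.comp (Fin k) (Fin k) n n ℂ (CStarMatrix.ofMatrix.symm (M.map (krausMap V)))
        = ∑ r, ((1 : Matrix (Fin k) (Fin k) ℂ) ⊗ₖ krausOperator V r) *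
          Matrix.comp (Fin k) (Fin k) m m ℂ (CStarMatrix.ofMatrix.symm M) *
          ((1 : Matrix (Fin k) (Fin k) ℂ) ⊗ₖ krausOperator V r)ᴴ := by
      ext ⟨i, a⟩ ⟨j, b⟩
      rw [Matrix.comp_apply, Matrix.sum_apply]
      change krausMap V (M i j) a b = _
      rw [krausMap_apply, Matrix.sum_apply]
      refine Finset.sum_congr rfl fun r _ => ?_
      simp only [Matrix.mul_apply, Fintype.sum_prod_type, Matrix.conjTranspose_apply,
        Matrix.kroneckerMap_apply, Matrix.one_apply, Matrix.comp_apply]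
      simp [apply_ite (starRingEnd ℂ)]
    change (Matrix.comp (Fin k) (Fin k) n n ℂ
      (CStarMatrix.ofMatrix.symm (M.map (krausMap V)))).PosSemidef
    rw [this]
    exact Matrix.posSemidef_sum _ fun r _ => hM.mul_mul_conjTranspose_same _
  trace_map X := by
    change (krausMap V X).trace = _
    have h : ∑ r, (krausOperator V r)ᴴ * krausOperator V r = 1 := by
      rw [← hV]
      ext i j
      simp only [Matrix.sum_apply, Matrix.mul_apply, Fintype.sum_prod_type,
        Matrix.conjTranspose_apply, krausOperator, Matrix.of_apply]
      exact Finset.sum_comm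
    rw [krausMap_apply, Matrix.trace_sum]
    calc ∑ r, (krausOperator V r * X * (krausOperator V r)ᴴ).trace
        = ∑ r, ((krausOperator V r)ᴴ * krausOperator V r * X).trace := by
          refine Finset.sum_congr rfl fun r _ => ?_
          rw [Matrix.trace_mul_comm, Matrix.mul_assoc]
      _ = X.trace := by rw [← Matrix.trace_sum, ← Matrix.sum_mul, h, Matrix.one_mul]

theorem krausChannel_toLin {p : ℕ} (V : Matrix (n × Fin p) m ℂ) (hV : Vᴴ * V = 1) :
    (krausChannel V hV).toLin = krausMap V := rfl

end Kraus

/-! ### Partial trace of the dilated operator. -/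

section TensorKraus

open scoped ComplexOrder

/-- The operator `V ρ V†` on `(A' ⊗ B') ⊗ (A'' ⊗ B'')` for `V = V_A ⊗ V_B`. -/
def dilatedOperator {A B A' B' : Type*} [Fintype A] [Fintype B] {p q : ℕ} (V : Matrix (A' × Fin p) A ℂ) (W : Matrix (B' × Fin q) B ℂ)
    (X : Matrix (A × B) (A × B) ℂ) :
    Matrix ((A' × B') × (Fin p × Fin q)) ((A' × B') × (Fin p × Fin q)) ℂ :=
  ((V ⊗ₖ W) * X * (V ⊗ₖ W)ᴴ).reindex
    (Equiv.prodProdProdComm A' (Fin p) B' (Fin q)) (Equiv.prodProdProdComm A' (Fin p) B' (Fin q))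

theorem dilatedOperator_posSemidef {A B A' B' : Type*} [Fintype A] [Fintype B] [Fintype A']
    [Fintype B'] {p q : ℕ} (V : Matrix (A' × Fin p) A ℂ) (W : Matrix (B' × Fin q) B ℂ)
    {X : Matrix (A × B) (A × B) ℂ} (hX : X.PosSemidef) :
    (dilatedOperator V W X).PosSemidef :=
  (hX.mul_mul_conjTranspose_same _).submatrix _

variable {A B A' B' : Type*} [Fintype A] [DecidableEq A] [Fintype B] [DecidableEq B]
  [Fintype A'] [DecidableEq A'] [Fintype B'] [DecidableEq B'] {p q : ℕ}

theorem tensorMap_krausMap (V : Matrix (A' × Fin p) A ℂ) (W : Matrix (B' × Fin q) B ℂ)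
    (X : Matrix (A × B) (A × B) ℂ) :
    tensorMap (krausMap V) (krausMap W) X = ∑ rs : Fin p × Fin q,
      (krausOperator V rs.1 ⊗ₖ krausOperator W rs.2) * X *
        (krausOperator V rs.1 ⊗ₖ krausOperator W rs.2)ᴴ := by
  obtain ⟨t, rfl⟩ := (kroneckerLinearEquiv A A B B ℂ).surjective X
  simp only [tensorMap, LinearMap.comp_apply, LinearEquiv.coe_coe, LinearEquiv.symm_apply_apply]
  induction t using TensorProduct.induction_on with
  | zero => simp
  | add x y hx hy =>
    simp only [map_add, hx, hy, Matrix.mul_add, Matrix.add_mul, Finset.sum_add_distrib]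
  | tmul x y =>
    rw [TensorProduct.map_tmul, kroneckerLinearEquiv_tmul, kroneckerLinearEquiv_tmul,
      krausMap_apply, krausMap_apply]
    have : ∀ (f : Fin p → Matrix A' A' ℂ) (g : Fin q → Matrix B' B' ℂ),
        (∑ r, f r) ⊗ₖ (∑ s, g s) = ∑ rs : Fin p × Fin q, f rs.1 ⊗ₖ g rs.2 := by
      intro f g
      ext ⟨a, b⟩ ⟨c, d⟩
      simp only [Matrix.kroneckerMap_apply, Matrix.sum_apply, Finset.sum_mul_sum,
        Fintype.sum_prod_type]
    rw [this]
    refine Finset.sum_congr rfl fun rs _ => ?_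
    rw [Matrix.conjTranspose_kronecker, ← Matrix.mul_kronecker_mul, ← Matrix.mul_kronecker_mul]

theorem tensorMap_krausMap_posSemidef (V : Matrix (A' × Fin p) A ℂ) (W : Matrix (B' × Fin q) B ℂ)
    {X : Matrix (A × B) (A × B) ℂ} (hX : X.PosSemidef) :
    (tensorMap (krausMap V) (krausMap W) X).PosSemidef := by
  rw [tensorMap_krausMap]
  exact Matrix.posSemidef_sum _ fun rs _ => hX.mul_mul_conjTranspose_same _

/-- Tracing out the auxiliary systems of the dilated operator gives the output of the channels. -/
theorem trace_dilatedOperator_mul (V : Matrix (A' × Fin p) A ℂ) (W : Matrix (B' × Fin q) B ℂ)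
    (X : Matrix (A × B) (A × B) ℂ) (Φ : Matrix (A' × B') (A' × B') ℂ) :
    (dilatedOperator V W X * (Φ ⊗ₖ (1 : Matrix (Fin p × Fin q) (Fin p × Fin q) ℂ))).trace
      = (tensorMap (krausMap V) (krausMap W) X * Φ).trace := by
  -- The blocks over `A''B''` are indexed by pairs of Kraus indices; `Φ ⊗ 1` keeps only the diagonal
  -- blocks.
  have hent : ∀ x y rs tu, dilatedOperator V W X (x, rs) (y, tu)
      = ((krausOperator V rs.1 ⊗ₖ krausOperator W rs.2) * X *
        (krausOperator V tu.1 ⊗ₖ krausOperator W tu.2)ᴴ) x y := fun _ _ _ _ => rfl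
  rw [tensorMap_krausMap, Matrix.sum_mul, Matrix.trace_sum]
  simp only [Matrix.trace, Matrix.diag_apply]
  rw [Fintype.sum_prod_type_right]
  refine Finset.sum_congr rfl fun rs _ => Finset.sum_congr rfl fun x _ => ?_
  rw [Matrix.mul_apply, Fintype.sum_prod_type, Matrix.mul_apply]
  refine Finset.sum_congr rfl fun y _ => ?_
  rw [Finset.sum_eq_single rs]
  · rw [hent, Matrix.kroneckerMap_apply, Matrix.one_apply_eq, mul_one]
  · intro tu _ h
    rw [Matrix.kroneckerMap_apply, Matrix.one_apply_ne h]
    simp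
  · simp

end TensorKraus

/-! ### Compactness and existence of isometries. -/

section Isometries

/-- The isometries `ℂ^m → ℂ^n` form a compact set. -/
theorem isCompact_isometries (m n : Type*) [Fintype m] [DecidableEq m] [Fintype n] :
    IsCompact {V : Matrix n m ℂ | Vᴴ * V = 1} := by
  refine IsCompact.of_isClosed_subset
    (isCompact_univ_pi fun _ : n => isCompact_univ_pi fun _ : m => isCompact_closedBall (0 : ℂ) 1)
    ?_ ?_
  · exact isClosed_eq (by fun_prop) continuous_const
  · intro V hV i _ j _
    rw [mem_closedBall_zero_iff]
    have h := congrFun (congrFun (show Vᴴ * V = 1 from hV) j) j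
    rw [Matrix.mul_apply, Matrix.one_apply_eq] at h
    have h' : ∑ x, ‖V x j‖ ^ 2 = 1 := by
      have : ∀ x, Vᴴ j x * V x j = ((‖V x j‖ ^ 2 : ℝ) : ℂ) := by
        intro x
        rw [Matrix.conjTranspose_apply, RCLike.star_def, Complex.conj_mul']
        simp
      rw [Finset.sum_congr rfl fun x _ => this x] at h
      exact_mod_cast h
    have h2 : ‖V i j‖ ^ 2 ≤ 1 := by
      rw [← h']
      exact Finset.single_le_sum (f := fun x => ‖V x j‖ ^ 2) (fun _ _ => by positivity)
        (Finset.mem_univ i)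
    exact (sq_le_one_iff₀ (norm_nonneg _)).mp h2

/-- There is an isometry into a space of at least the same dimension. -/
theorem exists_isometry (m n : Type*) [Fintype m] [DecidableEq m] [Fintype n] [DecidableEq n]
    (h : Fintype.card m ≤ Fintype.card n) : ∃ V : Matrix n m ℂ, Vᴴ * V = 1 := by
  obtain ⟨f⟩ := Function.Embedding.nonempty_of_card_le h
  refine ⟨(1 : Matrix n n ℂ).submatrix id f, ?_⟩
  ext i j
  simp [Matrix.mul_apply, Matrix.one_apply, f.injective.eq_iff, eq_comm]

end Isometries

/-! ### Comparing channel and isometric fidelities. -/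

section Extractability

variable {A B A' B' : Type*} [Fintype A] [DecidableEq A] [Fintype B] [DecidableEq B]
  [Fintype A'] [DecidableEq A'] [Fintype B'] [DecidableEq B']
  {ρ : Matrix (A × B) (A × B) ℂ} {Φ : Matrix (A' × B') (A' × B') ℂ}

theorem IsState.nonempty {n : Type*} [Fintype n] {ρ : Matrix n n ℂ} (hρ : IsState ρ) :
    Nonempty n := by
  by_contra h
  rw [not_nonempty_iff] at h
  simpa [Matrix.trace] using hρ.trace_eq_one

theorem fidelity_tensorMap_krausMap (hρ : IsState ρ) (hΦ : IsPureState Φ) {p q : ℕ}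
    (V : Matrix (A' × Fin p) A ℂ) (W : Matrix (B' × Fin q) B ℂ) :
    fidelity (tensorMap (krausMap V) (krausMap W) ρ) Φ
      = (dilatedOperator V W ρ * (Φ ⊗ₖ (1 : Matrix (Fin p × Fin q) (Fin p × Fin q) ℂ))).trace.re := by
  rw [trace_dilatedOperator_mul,
    fidelity_pure (tensorMap_krausMap_posSemidef V W hρ.posSemidef) hΦ]

theorem channelFidelities_eq_image (hρ : IsState ρ) (hΦ : IsPureState Φ) :
    channelFidelities ρ Φ = (fun VW : Matrix (A' × Fin (Fintype.card A * Fintype.card A')) A ℂ ×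
        Matrix (B' × Fin (Fintype.card B * Fintype.card B')) B ℂ =>
      (dilatedOperator VW.1 VW.2 ρ * (Φ ⊗ₖ 1)).trace.re) ''
        ({V | Vᴴ * V = 1} ×ˢ {W | Wᴴ * W = 1}) := by
  ext f
  constructor
  · rintro ⟨ΛA, ΛB, rfl⟩
    obtain ⟨V, hV, hΛA⟩ := ΛA.exists_stinespring
    obtain ⟨W, hW, hΛB⟩ := ΛB.exists_stinespring
    exact ⟨(V, W), ⟨hV, hW⟩, by rw [hΛA, hΛB, fidelity_tensorMap_krausMap hρ hΦ]⟩
  · rintro ⟨⟨V, W⟩, ⟨hV, hW⟩, rfl⟩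
    exact ⟨krausChannel V hV, krausChannel W hW, by
      rw [krausChannel_toLin, krausChannel_toLin, fidelity_tensorMap_krausMap hρ hΦ]⟩

theorem isCompact_channelFidelities (hρ : IsState ρ) (hΦ : IsPureState Φ) :
    IsCompact (channelFidelities ρ Φ) := by
  rw [channelFidelities_eq_image hρ hΦ]
  refine ((isCompact_isometries _ _).prod (isCompact_isometries _ _)).image ?_
  have hk : Continuous fun VW : Matrix (A' × Fin (Fintype.card A * Fintype.card A')) A ℂ ×
      Matrix (B' × Fin (Fintype.card B * Fintype.card B')) B ℂ => VW.1 ⊗ₖ VW.2 := by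
    refine continuous_matrix fun i j => ?_
    simp only [Matrix.kroneckerMap_apply]
    fun_prop
  refine Complex.continuous_re.comp (Continuous.matrix_trace (Continuous.matrix_mul ?_
    continuous_const))
  exact ((hk.matrix_mul continuous_const).matrix_mul hk.matrix_conjTranspose).matrix_submatrix _ _

theorem channelFidelities_nonempty (ρ : Matrix (A × B) (A × B) ℂ) (hΦ : IsPureState Φ) :
    (channelFidelities ρ Φ).Nonempty := by
  obtain ⟨⟨a', b'⟩⟩ := hΦ.toIsState.nonempty
  have : Nonempty A' := ⟨a'⟩
  have : Nonempty B' := ⟨b'⟩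
  have hcard : ∀ k l : ℕ, 0 < l → k ≤ l * (k * l) := fun k l hl =>
    le_trans (Nat.le_mul_of_pos_right k hl) (Nat.le_mul_of_pos_left _ hl)
  obtain ⟨V, hV⟩ := exists_isometry A (A' × Fin (Fintype.card A * Fintype.card A'))
    (by simpa using hcard _ _ Fintype.card_pos)
  obtain ⟨W, hW⟩ := exists_isometry B (B' × Fin (Fintype.card B * Fintype.card B'))
    (by simpa using hcard _ _ Fintype.card_pos)
  exact ⟨_, krausChannel V hV, krausChannel W hW, rfl⟩

theorem exists_channelFidelity_ge (hρ : IsState ρ) (hΦ : IsPureState Φ) {f : ℝ}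
    (hf : f ∈ isometryFidelities ρ Φ) : ∃ g ∈ channelFidelities ρ Φ, f ≤ g := by
  obtain ⟨p, q, V, W, σ, hV, hW, hσ, rfl⟩ := hf
  refine ⟨_, ⟨krausChannel V hV, krausChannel W hW, rfl⟩, ?_⟩
  rw [krausChannel_toLin, krausChannel_toLin, fidelity_tensorMap_krausMap hρ hΦ]
  exact fidelity_pure_kronecker_le hΦ (dilatedOperator_posSemidef V W hρ.posSemidef) hσ

theorem channelFidelities_subset_isometryFidelities (hρ : IsState ρ) (hΦ : IsPureState Φ) :
    channelFidelities ρ Φ ⊆ isometryFidelities ρ Φ := by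
  rintro f ⟨ΛA, ΛB, rfl⟩
  obtain ⟨V, hV, hΛA⟩ := ΛA.exists_stinespring
  obtain ⟨W, hW, hΛB⟩ := ΛB.exists_stinespring
  -- The auxiliary space must be nonzero to carry a state `σ`.
  obtain ⟨⟨a, b⟩⟩ := hρ.nonempty
  obtain ⟨⟨a', b'⟩⟩ := hΦ.toIsState.nonempty
  have : Nonempty A := ⟨a⟩
  have : Nonempty B := ⟨b⟩
  have : Nonempty A' := ⟨a'⟩
  have : Nonempty B' := ⟨b'⟩
  have : NeZero (Fintype.card A * Fintype.card A') :=
    ⟨(Nat.mul_pos Fintype.card_pos Fintype.card_pos).ne'⟩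
  have : NeZero (Fintype.card B * Fintype.card B') :=
    ⟨(Nat.mul_pos Fintype.card_pos Fintype.card_pos).ne'⟩
  obtain ⟨σ, hσ, h⟩ := exists_isState_fidelity_pure_kronecker hΦ
    (dilatedOperator_posSemidef V W hρ.posSemidef)
  refine ⟨_, _, V, W, σ, hV, hW, hσ, ?_⟩
  rw [hΛA, hΛB, fidelity_tensorMap_krausMap hρ hΦ, ← h]
  rfl

end Extractability

theorem mainTheorem3 {A B A' B' : Type*} [Fintype A] [DecidableEq A] [Fintype B] [DecidableEq B]
    [Fintype A'] [DecidableEq A'] [Fintype B'] [DecidableEq B']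
    (ρ : Matrix (A × B) (A × B) ℂ) (hρ : IsState ρ)
    (Φ : Matrix (A' × B') (A' × B') ℂ) (hΦ : IsPureState Φ) :
    IsGreatest (channelFidelities ρ Φ) (extractability ρ Φ) ∧
      IsLUB (isometryFidelities ρ Φ) (isometricFidelity ρ Φ) ∧
      extractability ρ Φ = isometricFidelity ρ Φ := by
  have hgr : IsGreatest (channelFidelities ρ Φ) (extractability ρ Φ) :=
    (isCompact_channelFidelities hρ hΦ).isGreatest_sSup (channelFidelities_nonempty ρ hΦ)
  -- The maximal channel fidelity bounds all isometric ones and is itself one of them.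
  have hlub : IsLUB (isometryFidelities ρ Φ) (extractability ρ Φ) := by
    refine ⟨fun f hf => ?_, fun c hc => ?_⟩
    · obtain ⟨g, hg, hfg⟩ := exists_channelFidelity_ge hρ hΦ hf
      exact hfg.trans (hgr.2 hg)
    · exact hc (channelFidelities_subset_isometryFidelities hρ hΦ hgr.1)
  have heq : isometricFidelity ρ Φ = extractability ρ Φ := hlub.csSup_eq hlub.nonempty
  exact ⟨hgr, heq ▸ hlub, heq.symm⟩
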